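/- **Theorem 2.6.** Let $\mathbf K$ be $\mathbb R$, $\mathbb C$, or a spherically complete non-Archimedean field with non-trivial multiplicative norm, and let $X$ be a locally convex space over $\mathbf K$ (not necessarily Hausdorff). For a topological space $D$ let $2^D_\delta$ be the family of all closed $G_\delta$-subsets of $D$, including $\emptyset$. Let $O(X)$ be the vector space of continuous linear operators $X\to X$ and $L(X)\subset O(X)$ the set of linear topological homeomorphisms of $X$ onto $X$. Let $\mathcal V$ be a base of neighbourhoods of zero in $X$; if $X$ has a bounded neighbourhood of zero, the members of $\mathcal V$ are taken to be bounded (for a normed space, e.g., the balls around $0$). The set $L(X)$ carries the uniformity generated by the sets $\{(A,B): B-A\in W(U,V)\}$, $U,V\in\mathcal V$, where $W(U,V)=\{S\in O(X): S(U)\subset V\}$, and the induced topology. Let $D$ be $X$ or $L(X)$, put $E=X$ or $E=O(X)$ respectively, so that $D\subset E$, and let closures be taken in $D$. A function $\rho: D\times 2^D_\delta\to[0,\infty]$ is called a (conditional) $\kappa$-norm if for all $x,y\in D$, $C,C',C_1,C_2\in 2^D_\delta$ and $0\ne\lambda\in\mathbf K$: * (N1) $\rho(x,C)=0$ if and only if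 $x\in C$; * (N2) if $C\subset C'$, then $\rho(x,C)\ge\rho(x,C')$; * (N3) $x\mapsto\rho(x,C)$ is uniformly continuous on $D$ for each fixed $C\neq\emptyset$; * (N4) $\rho(x,C)=\inf_\alpha\rho(x,C_\alpha)$ for each increasing transfinite sequence $\{C_\alpha\}$ in $2^D_\delta$ with $C:=\mathrm{cl}(\bigcup_\alpha C_\alpha)\in 2^D_\delta$; * (N5)(a) $\rho(x+y,\mathrm{cl}(C_1+C_2))\le\rho(x,C_1)+\rho(y,C_2)$ whenever $x+y\in D$, $C_1+C_2\subset D$ and $\mathrm{cl}(C_1+C_2)\in 2^D_\delta$; * (N5)(b) $\rho(x,C_1)\le\rho(x,C_2)+\sup_{z\in C_2}\rho(z,C_1)$; * (N6) $\rho(\lambda x,\lambda C)=|\lambda|\,\rho(x,C)$ whenever $\lambda x\in D$, $\lambda C\subset D$ and $\lambda C\in 2^D_\delta$; * (N7) $\rho(x+y,y+C)=\rho(x,C)$ whenever $x+y\in D$, $y+C\subset D$ and $y+C\in 2^D_\delta$; * (N8) $\rho(x,\emptyset)=\infty$, and $\rho(x,C)<\infty$ if $C\ne\emptyset$; where in the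 non-Archimedean case the sums on the right-hand sides of (N5)(a) and (N5)(b) are replaced by maxima. The pair $(X,2^X_\delta)$ is called $\kappa$-normable, respectively $(L(X),2^{L(X)}_\delta)$ is called conditionally $\kappa$-normable, if such a function $\rho$ exists for $D=X$, respectively for $D=L(X)$. If $(X,2^X_\delta)$ is $\kappa$-normable, then $(L(X),2^{L(X)}_\delta)$ is conditionally $\kappa$-normable (for every such base $\mathcal V$). -/

import Mathlib

open Set Filter Topology Uniformity
open scoped ENNReal Pointwise

universe u v

namespace KappaNorm

/-- The family `2^D_δ` of all closed `G_δ`-subsets of `D` (the empty set is a member). -/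
def closedGdelta (D : Type*) [TopologicalSpace D] : Set (Set D) :=
  {C | IsClosed C ∧ IsGδ C}

/-- `ρ` is a (conditional) κ-norm on `D × 2^D_δ`, where the uniform space `D` is mapped into a
`𝕜`-vector space `E` by an injection `ι` and where `op` is the operation on the right-hand sides
of the triangle inequalities (`+`, or `max` over a non-Archimedean field).

Every axiom that mentions an algebraic operation is required exactly when the results of the
operation lie in `D` and in `2^D_δ`: the point `z : D` with `ι z = ι x + ι y` stands for `x + y`,
the set `T : Set D` with `ι '' T = ι '' C₁ + ι '' C₂` stands for `C₁ + C₂`, and so on.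
For `D = E` and `ι = id` such `z`, `T` always exist and these are the axioms of a κ-norm on the
vector space `E`. The values of `ρ` outside `D × 2^D_δ` play no role. -/
structure IsKappaNorm (𝕜 : Type*) [NormedField 𝕜] (op : ℝ≥0∞ → ℝ≥0∞ → ℝ≥0∞)
    {D : Type v} [UniformSpace D] {E : Type*} [AddCommGroup E] [Module 𝕜 E]
    (ι : D → E) (ρ : D → Set D → ℝ≥0∞) : Prop where
  N1 : ∀ x : D, ∀ C ∈ closedGdelta D, ρ x C = 0 ↔ x ∈ C
  N2 : ∀ x : D, ∀ C ∈ closedGdelta D, ∀ C' ∈ closedGdelta D, C ⊆ C' → ρ x C' ≤ ρ x C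
  /-- For nonempty `C` the values are finite by `N8`, so `toReal` loses nothing. -/
  N3 : ∀ C ∈ closedGdelta D, C.Nonempty → UniformContinuous fun x : D => (ρ x C).toReal
  /-- Increasing transfinite sequences are families indexed by a well-ordered type `I`; any such
  sequence of subsets of `D` reduces, on omitting repetitions, to one indexed in the universe
  of `D`. -/
  N4 : ∀ (I : Type v) [LinearOrder I] [WellFoundedLT I] (C : I → Set D),
    Monotone C → (∀ i, C i ∈ closedGdelta D) → closure (⋃ i, C i) ∈ closedGdelta D →
    ∀ x : D, ρ x (closure (⋃ i, C i)) = ⨅ i, ρ x (C i)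
  N5a : ∀ x y z : D, ι z = ι x + ι y →
    ∀ C₁ ∈ closedGdelta D, ∀ C₂ ∈ closedGdelta D, ∀ T : Set D, ι '' T = ι '' C₁ + ι '' C₂ →
    closure T ∈ closedGdelta D → ρ z (closure T) ≤ op (ρ x C₁) (ρ y C₂)
  N5b : ∀ x : D, ∀ C₁ ∈ closedGdelta D, ∀ C₂ ∈ closedGdelta D,
    ρ x C₁ ≤ op (ρ x C₂) (⨆ y ∈ C₂, ρ y C₁)
  N6 : ∀ c : 𝕜, c ≠ 0 → ∀ x z : D, ι z = c • ι x →
    ∀ C ∈ closedGdelta D, ∀ T ∈ closedGdelta D, ι '' T = c • ι '' C →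
    ρ z T = ‖c‖ₑ * ρ x C
  N7 : ∀ x y z : D, ι z = ι x + ι y →
    ∀ C ∈ closedGdelta D, ∀ T ∈ closedGdelta D, ι '' T = (fun e => ι y + e) '' (ι '' C) →
    ρ z T = ρ x C
  N8_empty : ∀ x : D, ρ x ∅ = ∞
  N8_nonempty : ∀ x : D, ∀ C ∈ closedGdelta D, C.Nonempty → ρ x C < ∞

/-- `(X, 2^X_δ)` is κ-normable. -/
def KappaNormable (𝕜 : Type*) [NormedField 𝕜] (op : ℝ≥0∞ → ℝ≥0∞ → ℝ≥0∞)
    (X : Type*) [AddCommGroup X] [Module 𝕜 X] [UniformSpace X] : Prop :=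
  ∃ ρ : X → Set X → ℝ≥0∞, IsKappaNorm 𝕜 op (id : X → X) ρ

/-- A base of neighbourhoods of zero in `X`. It is required to consist of bounded sets as soon as
`X` has a bounded neighbourhood of zero, so that for a normed space `X` the sets `W(U,V)` below
describe the operator-norm topology (the balls around zero are such a base). No condition is
imposed when `X` has no bounded neighbourhood of zero. -/
structure ZeroBase (𝕜 : Type*) [NormedField 𝕜]
    (X : Type*) [AddCommGroup X] [Module 𝕜 X] [TopologicalSpace X] where
  sets : Set (Set X)
  hasBasis : (𝓝 (0 : X)).HasBasis (fun V => V ∈ sets) id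
  bounded : (∃ B ∈ 𝓝 (0 : X), Bornology.IsVonNBounded 𝕜 B) →
    ∀ U ∈ sets, Bornology.IsVonNBounded 𝕜 U

section HomeoSpace

variable (𝕜 : Type*) [NormedField 𝕜] (X : Type*) [AddCommGroup X] [Module 𝕜 X]

/-- The set `W(U,V)` of the continuous linear operators on `X` that map `U` into `V`. -/
def W [TopologicalSpace X] (U V : Set X) : Set (X →L[𝕜] X) :=
  {S | ∀ x ∈ U, S x ∈ V}

/-- The space `L(X)` of linear topological homeomorphisms of `X` onto itself, to be endowed with
the uniformity induced by `O(X)` and the sets `W(U,V)`, `U, V ∈ 𝒱`. -/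
@[nolint unusedArguments]
def HomeoSpace [TopologicalSpace X] (_ : ZeroBase 𝕜 X) : Type _ := X ≃L[𝕜] X

variable {𝕜 X}

/-- The inclusion of `L(X)` into the vector space `O(X)` of continuous linear operators. -/
def HomeoSpace.toOp [TopologicalSpace X] {𝒱 : ZeroBase 𝕜 X} (A : HomeoSpace 𝕜 X 𝒱) :
    X →L[𝕜] X :=
  ContinuousLinearEquiv.toContinuousLinearMap (show X ≃L[𝕜] X from A)

variable [UniformSpace X] [IsUniformAddGroup X]

/-- The uniformity of `L(X)`: it is generated by the sets of pairs `(A, B)` with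
`B - A ∈ W(U,V)`, where `U, V ∈ 𝒱`. -/
instance (𝒱 : ZeroBase 𝕜 X) : UniformSpace (HomeoSpace 𝕜 X 𝒱) :=
  UniformSpace.ofCore
    { uniformity := ⨅ U ∈ 𝒱.sets, ⨅ V ∈ 𝒱.sets,
        𝓟 {p : HomeoSpace 𝕜 X 𝒱 × HomeoSpace 𝕜 X 𝒱 | p.2.toOp - p.1.toOp ∈ W 𝕜 X U V}
      refl := by
        simp only [le_iInf_iff, le_principal_iff, mem_principal]
        rintro U - V hV ⟨A, B⟩ hAB
        obtain rfl : A = B := hAB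
        intro x _
        simpa using mem_of_mem_nhds (𝒱.hasBasis.mem_of_mem hV)
      symm := by
        simp only [tendsto_iInf, tendsto_principal]
        intro U hU V hV
        have h : -(id V) ∈ 𝓝 (0 : X) := by
          have := 𝒱.hasBasis.mem_of_mem hV
          simpa using neg_mem_nhds_zero X this
        obtain ⟨V', hV', hsub⟩ := 𝒱.hasBasis.mem_iff.1 h
        refine mem_of_superset (mem_iInf_of_mem U (mem_iInf_of_mem hU (mem_iInf_of_mem V'
          (mem_iInf_of_mem hV' (mem_principal_self _))))) ?_
        rintro ⟨A, B⟩ hAB x hx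
        have h1 := hsub (hAB x hx)
        simpa using h1
      comp := by
        simp only [le_iInf_iff, le_principal_iff]
        intro U hU V hV
        obtain ⟨V₀, hV₀, hadd⟩ := exists_nhds_zero_half (𝒱.hasBasis.mem_of_mem hV)
        obtain ⟨V', hV', hsub⟩ := 𝒱.hasBasis.mem_iff.1 hV₀
        refine mem_of_superset (mem_lift' (mem_iInf_of_mem U (mem_iInf_of_mem hU
          (mem_iInf_of_mem V' (mem_iInf_of_mem hV' (mem_principal_self _)))))) ?_
        rintro ⟨A, B⟩ ⟨C, h1, h2⟩ x hx
        have := hadd _ (hsub (h1 x hx)) _ (hsub (h2 x hx))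
        simpa using this }

end HomeoSpace

/-- `(L(X), 2^{L(X)}_δ)` is conditionally κ-normable, `L(X)` carrying the uniformity given by the
base `𝒱` of neighbourhoods of zero in `X`. -/
def ConditionallyKappaNormable {𝕜 : Type*} [NormedField 𝕜] (op : ℝ≥0∞ → ℝ≥0∞ → ℝ≥0∞)
    {X : Type*} [AddCommGroup X] [Module 𝕜 X] [UniformSpace X] [IsUniformAddGroup X]
    [ContinuousSMul 𝕜 X] (𝒱 : ZeroBase 𝕜 X) : Prop :=
  ∃ ρ : HomeoSpace 𝕜 X 𝒱 → Set (HomeoSpace 𝕜 X 𝒱) → ℝ≥0∞,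
    IsKappaNorm 𝕜 op (HomeoSpace.toOp : HomeoSpace 𝕜 X 𝒱 → (X →L[𝕜] X)) ρ

/-- A normed field is spherically complete if every decreasing sequence of closed balls has a
common point. -/
def SphericallyComplete (K : Type*) [NormedField K] : Prop :=
  ∀ (a : ℕ → K) (r : ℕ → ℝ), (∀ n, 0 < r n) →
    Antitone (fun n => Metric.closedBall (a n) (r n)) →
    (⋂ n, Metric.closedBall (a n) (r n)).Nonempty

/-- Local convexity over a non-Archimedean field: every neighbourhood of zero contains a
neighbourhood of zero that is absolutely `K`-convex. -/
def LocallyKConvex (K : Type*) [NormedField K] (X : Type*) [AddCommGroup X] [Module K X]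
    [TopologicalSpace X] : Prop :=
  ∀ V ∈ 𝓝 (0 : X), ∃ G ∈ 𝓝 (0 : X), G ⊆ V ∧
    ∀ a b : K, ‖a‖ ≤ 1 → ‖b‖ ≤ 1 → ∀ x ∈ G, ∀ y ∈ G, a • x + b • y ∈ G

end KappaNorm

namespace KappaNorm

/-! A κ-norm forces the topology of X to come from a single seminorm. For a closed Gδ subspace N,
the axioms make p_N = ρ(·, N) a continuous seminorm with kernel N, and p_N induces the quotient
topology of X/N (`exists_ball_subset_add`). Since every neighbourhood of zero contains such an N, it
suffices to find a least one, M: then p_M alone defines the topology.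

The existence of M is where (N4) enters. Well-order the subspaces N_i. If initial segments have
lower bounds but the whole family has none, the sets C_i = cl ⋃_{j ≤ i} {p_{N_j} ≥ 1} are closed Gδ
sets avoiding 0 with dense union, so inf ρ(0, C_i) = ρ(0, X) = 0. Each term being positive,
countably many indices are cofinal, and a countable meet of lower bounds is a lower bound after all
(`exists_le_of_forall_initial`).

Once X is seminormed, the base consists of bounded sets, L(X) carries the operator-norm uniformity
(`isUniformInducing_toOp`), and the distance to a set is the required ρ (`isKappaNorm_infEDist`). -/

/-- The properties that `+` and `max` share as operations on the right-hand sides of triangle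
inequalities. -/
structure IsTriangleOp (op : ℝ≥0∞ → ℝ≥0∞ → ℝ≥0∞) : Prop where
  mono : ∀ {a a' b b' : ℝ≥0∞}, a ≤ a' → b ≤ b' → op a b ≤ op a' b'
  le_add : ∀ a b : ℝ≥0∞, op a b ≤ a + b
  left_le : ∀ a b : ℝ≥0∞, a ≤ op a b
  right_le : ∀ a b : ℝ≥0∞, b ≤ op a b
  le_of_forall_gt : ∀ {a b c : ℝ≥0∞}, a ≠ ∞ → b ≠ ∞ →
    (∀ a' > a, ∀ b' > b, c ≤ op a' b') → c ≤ op a b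

theorem isTriangleOp_add : IsTriangleOp fun s t => s + t where
  mono := add_le_add
  le_add _ _ := le_rfl
  left_le _ _ := le_self_add
  right_le _ _ := le_add_self
  le_of_forall_gt {a b c} ha hb h := by
    refine ENNReal.le_of_forall_pos_le_add fun ε hε _ => ?_
    have hε2 : ((ε : ℝ≥0∞) / 2) ≠ 0 := by simp [hε.ne']
    refine (h (a + ε / 2) (ENNReal.lt_add_right ha hε2) (b + ε / 2)
      (ENNReal.lt_add_right hb hε2)).trans_eq ?_
    rw [add_add_add_comm, ENNReal.add_halves]

theorem isTriangleOp_max : IsTriangleOp fun s t => max s t where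
  mono := max_le_max
  le_add _ _ := max_le le_self_add le_add_self
  left_le := le_max_left
  right_le := le_max_right
  le_of_forall_gt {a b c} _ _ h := by
    refine le_of_forall_gt_imp_ge_of_dense fun d hd => ?_
    simpa using h d ((le_max_left a b).trans_lt hd) d ((le_max_right a b).trans_lt hd)

/-! ### Distance functions as conditional κ-norms -/

section Distance

open Metric

variable {𝕜 : Type*} [NormedField 𝕜] {op : ℝ≥0∞ → ℝ≥0∞ → ℝ≥0∞} {D : Type v} [UniformSpace D]
  {E : Type*} [SeminormedAddCommGroup E] [NormedSpace 𝕜 E] {ι : D → E}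

/-- The distance to a set is a conditional κ-norm on every subspace of a seminormed space. -/
theorem isKappaNorm_infEDist (hι : IsUniformInducing ι) (hop : IsTriangleOp op)
    (hE : ∀ a b : E, ‖a + b‖ₑ ≤ op ‖a‖ₑ ‖b‖ₑ) :
    IsKappaNorm 𝕜 op ι fun x C => infEDist (ι x) (ι '' C) where
  N1 x C hC := by
    rw [← mem_closure_iff_infEDist_zero, ← mem_preimage,
      ← hι.isInducing.closure_eq_preimage_closure_image, hC.1.closure_eq]
  N2 x C _ C' _ h := infEDist_anti (image_mono h)
  N3 C _ _ := (uniformContinuous_infDist_pt (ι '' C)).comp hι.uniformContinuous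
  N4 I _ _ C _ _ _ x := by
    rw [← infEDist_iUnion, ← image_iUnion]
    refine le_antisymm (infEDist_anti (image_mono subset_closure)) ?_
    rw [← infEDist_closure (s := ι '' ⋃ i, C i)]
    exact infEDist_anti (image_closure_subset_closure_image hι.uniformContinuous.continuous)
  N5a x y z hz C₁ _ C₂ _ T hT _ := by
    refine (infEDist_anti (image_mono subset_closure)).trans ?_
    -- Infinite distances make the right side infinite. For finite ones, near-optimal points are
    -- chosen and `le_of_forall_gt`, a right-continuity of `op`, passes to the infima.
    rcases eq_or_ne (infEDist (ι x) (ι '' C₁)) ∞ with h₁ | h₁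
    · exact le_trans (by rw [h₁]; exact le_top) (hop.left_le _ _)
    rcases eq_or_ne (infEDist (ι y) (ι '' C₂)) ∞ with h₂ | h₂
    · exact le_trans (by rw [h₂]; exact le_top) (hop.right_le _ _)
    refine hop.le_of_forall_gt h₁ h₂ fun a ha b hb => ?_
    obtain ⟨u, hu, hua⟩ := infEDist_lt_iff.1 ha
    obtain ⟨w, hw, hwb⟩ := infEDist_lt_iff.1 hb
    rw [hT, hz]
    refine (infEDist_le_edist_of_mem (add_mem_add hu hw)).trans ?_
    rw [edist_eq_enorm_sub] at hua hwb ⊢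
    rw [add_sub_add_comm]
    exact (hE _ _).trans (hop.mono hua.le hwb.le)
  N5b x C₁ _ C₂ _ := by
    rcases eq_or_ne (infEDist (ι x) (ι '' C₂)) ∞ with h₁ | h₁
    · exact le_trans (by rw [h₁]; exact le_top) (hop.left_le _ _)
    rcases eq_or_ne (⨆ y ∈ C₂, infEDist (ι y) (ι '' C₁)) ∞ with h₂ | h₂
    · exact le_trans (by rw [h₂]; exact le_top) (hop.right_le _ _)
    refine hop.le_of_forall_gt h₁ h₂ fun a ha b hb => ?_
    obtain ⟨_, ⟨y, hy, rfl⟩, hya⟩ := infEDist_lt_iff.1 ha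
    obtain ⟨w, hw, hwb⟩ := infEDist_lt_iff.1
      ((le_iSup₂ (f := fun y (_ : y ∈ C₂) => infEDist (ι y) (ι '' C₁)) y hy).trans_lt hb)
    refine (infEDist_le_edist_of_mem hw).trans ?_
    rw [edist_eq_enorm_sub] at hya hwb ⊢
    rw [← sub_add_sub_cancel (ι x) (ι y) w]
    exact (hE _ _).trans (hop.mono hya.le hwb.le)
  N6 c hc x z hz C _ T _ hT := by
    rw [hz, hT, infEDist_smul₀ hc]
    rfl
  N7 x y z hz C _ T _ hT := by
    rw [hz, hT, add_comm (ι x)]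
    exact infEDist_image (isometry_add_left (ι y))
  N8_empty x := by simp
  N8_nonempty x C _ hC := (infEDist_ne_top (hC.image ι)).lt_top

end Distance

/-! ### The operator-norm uniformity on L(X) -/

section Operators

variable {𝕜 : Type*} [NontriviallyNormedField 𝕜] {X : Type*} [SeminormedAddCommGroup X]
  [NormedSpace 𝕜 X]

theorem ZeroBase.isBounded (𝒱 : ZeroBase 𝕜 X) {U : Set X} (hU : U ∈ 𝒱.sets) :
    Bornology.IsBounded U :=
  (NormedSpace.isVonNBounded_iff 𝕜).1 <| 𝒱.bounded
    ⟨Metric.ball 0 1, Metric.ball_mem_nhds 0 one_pos, NormedSpace.isVonNBounded_ball 𝕜 X 1⟩ U hU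

/-- Any `U` contains a δ-ball. As the norm of `𝕜` is non-trivial, the operator norm is controlled on
the shell δ/‖c‖ ≤ ‖x‖ < δ, where the choice of `V` gives ‖S x‖ ≤ (ε/2)‖x‖. -/
theorem exists_W_subset_ball (𝒱 : ZeroBase 𝕜 X) {ε : ℝ} (hε : 0 < ε) :
    ∃ U ∈ 𝒱.sets, ∃ V ∈ 𝒱.sets, W 𝕜 X U V ⊆ Metric.ball 0 ε := by
  obtain ⟨U, hU, -⟩ := 𝒱.hasBasis.mem_iff.1 (univ_mem : (univ : Set X) ∈ 𝓝 0)
  obtain ⟨δ, hδ, hδU⟩ := Metric.mem_nhds_iff.1 (𝒱.hasBasis.mem_of_mem hU)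
  obtain ⟨c, hc⟩ := NormedField.exists_one_lt_norm 𝕜
  have hc0 : 0 < ‖c‖ := one_pos.trans hc
  obtain ⟨V, hV, hVη⟩ := 𝒱.hasBasis.mem_iff.1
    (Metric.ball_mem_nhds (0 : X) (show 0 < ε / 2 * (δ / ‖c‖) by positivity))
  refine ⟨U, hU, V, hV, fun S hS => ?_⟩
  rw [mem_ball_zero_iff]
  refine lt_of_le_of_lt (S.opNorm_le_of_shell hδ (half_pos hε).le hc fun x hx hxδ => ?_)
    (half_lt_self hε)
  have h1 := hVη (hS x (hδU (mem_ball_zero_iff.2 hxδ)))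
  rw [mem_ball_zero_iff] at h1
  exact h1.le.trans (by gcongr)

/-- This direction rests on the boundedness of the members of the base. -/
theorem exists_ball_subset_W (𝒱 : ZeroBase 𝕜 X) {U V : Set X} (hU : U ∈ 𝒱.sets)
    (hV : V ∈ 𝒱.sets) : ∃ ε > 0, Metric.ball 0 ε ⊆ W 𝕜 X U V := by
  obtain ⟨R, hR, hUR⟩ := (𝒱.isBounded hU).exists_pos_norm_le
  obtain ⟨η, hη, hηV⟩ := Metric.mem_nhds_iff.1 (𝒱.hasBasis.mem_of_mem hV)
  refine ⟨η / R, by positivity, fun S hS x hx => hηV ?_⟩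
  rw [mem_ball_zero_iff] at hS ⊢
  calc ‖S x‖ ≤ ‖S‖ * R := S.le_opNorm_of_le (hUR x hx)
    _ < η / R * R := by gcongr
    _ = η := div_mul_cancel₀ _ hR.ne'

/-- Over a seminormed space the uniformity of `L(X)` is that of the operator norm. -/
theorem isUniformInducing_toOp (𝒱 : ZeroBase 𝕜 X) :
    IsUniformInducing (HomeoSpace.toOp : HomeoSpace 𝕜 X 𝒱 → X →L[𝕜] X) := by
  have hU : 𝓤 (HomeoSpace 𝕜 X 𝒱) = ⨅ U ∈ 𝒱.sets, ⨅ V ∈ 𝒱.sets,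
    𝓟 {p : HomeoSpace 𝕜 X 𝒱 × HomeoSpace 𝕜 X 𝒱 | p.2.toOp - p.1.toOp ∈ W 𝕜 X U V} := rfl
  refine ⟨?_⟩
  rw [hU]
  refine le_antisymm ?_ ?_
  · simp only [le_iInf_iff, le_principal_iff]
    intro U hU V hV
    obtain ⟨ε, hε, h⟩ := exists_ball_subset_W 𝒱 hU hV
    refine ⟨_, Metric.dist_mem_uniformity hε, fun p hp => h ?_⟩
    rw [mem_ball_zero_iff, ← dist_eq_norm']
    exact hp
  · intro s hs
    obtain ⟨t, ht, hts⟩ := hs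
    obtain ⟨ε, hε, hεt⟩ := Metric.mem_uniformity_dist.1 ht
    obtain ⟨U, hU, V, hV, h⟩ := exists_W_subset_ball 𝒱 hε
    refine mem_of_superset (mem_iInf_of_mem U (mem_iInf_of_mem hU (mem_iInf_of_mem V
      (mem_iInf_of_mem hV (mem_principal_self _))))) fun p hp => hts (hεt ?_)
    have := h hp
    rwa [mem_ball_zero_iff, ← dist_eq_norm'] at this

theorem conditionallyKappaNormable_of_seminormed {op : ℝ≥0∞ → ℝ≥0∞ → ℝ≥0∞}
    (hop : IsTriangleOp op)
    (hX : ∀ a b : X →L[𝕜] X, ‖a + b‖ₑ ≤ op ‖a‖ₑ ‖b‖ₑ) (𝒱 : ZeroBase 𝕜 X) :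
    ConditionallyKappaNormable op 𝒱 :=
  ⟨_, isKappaNorm_infEDist (isUniformInducing_toOp 𝒱) hop hX⟩

end Operators

theorem preimage_mem_closedGdelta {X Y : Type*} [TopologicalSpace X] [TopologicalSpace Y]
    {f : X → Y} (hf : Continuous f) {C : Set Y} (hC : C ∈ closedGdelta Y) :
    f ⁻¹' C ∈ closedGdelta X :=
  ⟨hC.1.preimage hf, hC.2.preimage hf⟩

/-! ### Seminorms attached to closed Gδ subspaces -/

section Seminormable

variable {𝕜 : Type*} [NormedField 𝕜] {op : ℝ≥0∞ → ℝ≥0∞ → ℝ≥0∞}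
  {X : Type v} [AddCommGroup X] [Module 𝕜 X] [UniformSpace X]

variable (𝕜 X) in
/-- The subspaces of `X` that are closed `G_δ`-sets. -/
def GdeltaSubspace : Type v := {N : Submodule 𝕜 X // (N : Set X) ∈ closedGdelta X}

/-- A countable family of closed `G_δ`-subspaces has a closed `G_δ`-subspace as its meet. -/
theorem GdeltaSubspace.exists_le (N : ℕ → GdeltaSubspace 𝕜 X) :
    ∃ M : GdeltaSubspace 𝕜 X, ∀ n, M.1 ≤ (N n).1 :=
  ⟨⟨⨅ n, (N n).1, by
    rw [Submodule.coe_iInf]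
    exact ⟨isClosed_iInter fun n => (N n).2.1, .iInter fun n => (N n).2.2⟩⟩, fun n => iInf_le _ n⟩

variable (𝕜 X) in
/-- The two consequences of local convexity that make `X` the projective limit of its quotients by
closed `G_δ`-subspaces, common to the real, complex and non-Archimedean cases. -/
structure GdeltaSeparated : Prop where
  exists_subspace : ∀ V ∈ 𝓝 (0 : X), ∃ N : GdeltaSubspace 𝕜 X, (N.1 : Set X) ⊆ V
  exists_invariant : ∀ V ∈ 𝓝 (0 : X), ∀ M : Submodule 𝕜 X, ∃ C ∈ closedGdelta X,
    (0 : X) ∉ C ∧ (∀ x ∈ C, ∀ m ∈ M, x + m ∈ C) ∧ Cᶜ ⊆ V + (M : Set X)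

namespace IsKappaNorm

variable {ρ : X → Set X → ℝ≥0∞}

theorem ne_top (hρ : IsKappaNorm 𝕜 op (id : X → X) ρ) (N : GdeltaSubspace 𝕜 X) (x : X) :
    ρ x N.1 ≠ ∞ :=
  (hρ.N8_nonempty x _ N.2 ⟨0, N.1.zero_mem⟩).ne

theorem apply_add_le (hρ : IsKappaNorm 𝕜 op (id : X → X) ρ) (N : GdeltaSubspace 𝕜 X) (x y : X) :
    ρ (x + y) N.1 ≤ op (ρ x N.1) (ρ y N.1) := by
  have h := hρ.N5a x y (x + y) rfl N.1 N.2 N.1 N.2 N.1 (by simp)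
    (by rw [N.2.1.closure_eq]; exact N.2)
  rwa [N.2.1.closure_eq] at h

theorem apply_smul (hρ : IsKappaNorm 𝕜 op (id : X → X) ρ) (N : GdeltaSubspace 𝕜 X) (c : 𝕜)
    (x : X) : ρ (c • x) N.1 = ‖c‖ₑ * ρ x N.1 := by
  rcases eq_or_ne c 0 with rfl | hc
  · simpa using (hρ.N1 0 N.1 N.2).2 N.1.zero_mem
  · refine hρ.N6 c hc x _ rfl N.1 N.2 N.1 N.2 ?_
    simp only [image_id]
    ext y
    rw [mem_smul_set_iff_inv_smul_mem₀ hc]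
    exact (N.1.smul_mem_iff (inv_ne_zero hc)).symm

/-- The seminorm `x ↦ ρ(x, N)` attached to a closed `G_δ`-subspace `N`. -/
noncomputable def seminorm (hρ : IsKappaNorm 𝕜 op (id : X → X) ρ) (hop : IsTriangleOp op)
    (N : GdeltaSubspace 𝕜 X) : Seminorm 𝕜 X :=
  Seminorm.of (fun x => (ρ x N.1).toReal)
    (fun x y => by
      rw [← ENNReal.toReal_add (hρ.ne_top N x) (hρ.ne_top N y)]
      exact ENNReal.toReal_mono (ENNReal.add_ne_top.2 ⟨hρ.ne_top N x, hρ.ne_top N y⟩)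
        ((hρ.apply_add_le N x y).trans (hop.le_add _ _)))
    (fun c x => by simp [hρ.apply_smul N c x])

variable (hρ : IsKappaNorm 𝕜 op (id : X → X) ρ) (hop : IsTriangleOp op)

theorem seminorm_apply (N : GdeltaSubspace 𝕜 X) (x : X) :
    hρ.seminorm hop N x = (ρ x N.1).toReal := rfl

theorem ofReal_seminorm (N : GdeltaSubspace 𝕜 X) (x : X) :
    ENNReal.ofReal (hρ.seminorm hop N x) = ρ x N.1 :=
  ENNReal.ofReal_toReal (hρ.ne_top N x)

theorem seminorm_eq_zero_iff (N : GdeltaSubspace 𝕜 X) (x : X) :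
    hρ.seminorm hop N x = 0 ↔ x ∈ N.1 := by
  rw [seminorm_apply, ENNReal.toReal_eq_zero_iff, or_iff_left (hρ.ne_top N x)]
  exact hρ.N1 x _ N.2

theorem continuous_seminorm (N : GdeltaSubspace 𝕜 X) : Continuous (hρ.seminorm hop N) :=
  (hρ.N3 _ N.2 ⟨0, N.1.zero_mem⟩).continuous

theorem seminorm_anti {M N : GdeltaSubspace 𝕜 X} (h : M.1 ≤ N.1) (x : X) :
    hρ.seminorm hop N x ≤ hρ.seminorm hop M x :=
  ENNReal.toReal_mono (hρ.ne_top M x) (hρ.N2 x _ M.2 _ N.2 h)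

variable [IsUniformAddGroup X]

/-- The coset z + N lies in `C`, and translation invariance gives ρ(0, z + N) = ρ(-z, N) = p_N(z).
-/
theorem apply_zero_le {C : Set X} (hC : C ∈ closedGdelta X) (N : GdeltaSubspace 𝕜 X)
    (hCN : ∀ x ∈ C, ∀ m ∈ N.1, x + m ∈ C) {z : X} (hz : z ∈ C) :
    ρ 0 C ≤ ENNReal.ofReal (hρ.seminorm hop N z) := by
  have hT : (fun e => z + e) '' (N.1 : Set X) ∈ closedGdelta X := by
    have h := (Homeomorph.addLeft (-z)).continuous
    rw [image_add_left]
    exact preimage_mem_closedGdelta h N.2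
  rw [← map_neg_eq_map, hρ.ofReal_seminorm hop,
    ← hρ.N7 (-z) z 0 (by simp) N.1 N.2 _ hT (by simp)]
  refine hρ.N2 0 _ hT _ hC ?_
  rintro _ ⟨m, hm, rfl⟩
  exact hCN z hz m hm

-- Together with continuity of p_M, this identifies the topology of X/M. The radius is ρ(0, C) for
-- an M-invariant `C` missing 0 with complement inside V + M: by `apply_zero_le`, no point of `C`
-- has smaller p_M.
include hρ hop in
theorem exists_ball_subset_add (hX : GdeltaSeparated 𝕜 X) (M : GdeltaSubspace 𝕜 X) {V : Set X}
    (hV : V ∈ 𝓝 0) : ∃ ε > 0, ∀ z, hρ.seminorm hop M z < ε → z ∈ V + (M.1 : Set X) := by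
  obtain ⟨C, hC, h0, hCM, hCV⟩ := hX.exists_invariant V hV M.1
  rcases C.eq_empty_or_nonempty with rfl | hne
  · exact ⟨1, one_pos, fun z _ => hCV (notMem_empty z)⟩
  refine ⟨(ρ 0 C).toReal, ENNReal.toReal_pos (mt (hρ.N1 0 C hC).1 h0) (hρ.N8_nonempty 0 C hC hne).ne,
    fun z hz => hCV fun hzC => hz.not_ge ?_⟩
  exact ENNReal.toReal_le_of_le_ofReal (apply_nonneg _ _) (hρ.apply_zero_le hop hC M hCM hzC)

-- Modulo `M` the topology is that of p_M, so `F` is the intersection of its open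
-- 1/(n+1)-neighbourhoods, as in a pseudometric space.
include hρ hop in
theorem mem_closedGdelta_of_invariant (hX : GdeltaSeparated 𝕜 X) (M : GdeltaSubspace 𝕜 X)
    {F : Set X} (hF : IsClosed F) (hFM : ∀ x ∈ F, ∀ m ∈ M.1, x + m ∈ F) :
    F ∈ closedGdelta X := by
  refine ⟨hF, ?_⟩
  have h : F = ⋂ n : ℕ, ⋃ y ∈ F, {x | hρ.seminorm hop M (y - x) < 1 / ((n : ℝ) + 1)} := by
    refine Subset.antisymm (fun x hx => mem_iInter.2 fun n => mem_biUnion hx ?_) fun x hx => ?_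
    · simp only [mem_ofPred_eq, sub_self, map_zero]
      positivity
    · by_contra hxF
      have hV : {v | x + v ∈ Fᶜ} ∈ 𝓝 (0 : X) :=
        (hF.isOpen_compl.preimage (continuous_const_add x)).mem_nhds (by simpa using hxF)
      obtain ⟨ε, hε, hεV⟩ := hρ.exists_ball_subset_add hop hX M hV
      obtain ⟨n, hn⟩ := exists_nat_one_div_lt hε
      obtain ⟨y, hy, hyx⟩ := mem_iUnion₂.1 (mem_iInter.1 hx n)
      obtain ⟨v, hv, m, hm, hvm⟩ := hεV _ (hyx.trans hn)
      refine hv ?_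
      have : x + v = y + -m := by
        rw [eq_sub_of_add_eq hvm]
        abel
      rw [this]
      exact hFM y hy _ (M.1.neg_mem hm)
  rw [h]
  refine .iInter_of_isOpen fun n => isOpen_biUnion fun y _ => ?_
  exact isOpen_lt ((hρ.continuous_seminorm hop M).comp (continuous_const.sub continuous_id))
    continuous_const

end IsKappaNorm

end Seminormable

/-! ### Existence of a least closed Gδ subspace -/

section WellOrder

variable {𝕜 : Type*} [NontriviallyNormedField 𝕜] {op : ℝ≥0∞ → ℝ≥0∞ → ℝ≥0∞}
  {X : Type v} [AddCommGroup X] [Module 𝕜 X] [UniformSpace X] [IsUniformAddGroup X]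
  {ρ : X → Set X → ℝ≥0∞}

namespace IsKappaNorm

variable (hρ : IsKappaNorm 𝕜 op (id : X → X) ρ) (hop : IsTriangleOp op)
  (hX : GdeltaSeparated 𝕜 X)

-- This yields the density of ⋃ C_i: `V` contains a closed Gδ subspace, which is not below every
-- N_i, hence contains a line on which some p_{N_i} is unbounded.
omit [IsUniformAddGroup X] in
include hX in
theorem exists_large_add_mem {I : Type*} {N : I → GdeltaSubspace 𝕜 X}
    (hN : ¬ ∃ M : GdeltaSubspace 𝕜 X, ∀ i, M.1 ≤ (N i).1) (y : X) {V : Set X} (hV : V ∈ 𝓝 0) :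
    ∃ v ∈ V, ∃ i, 1 ≤ hρ.seminorm hop (N i) (y + v) := by
  obtain ⟨M, hMV⟩ := hX.exists_subspace V hV
  have hM : ¬ ∀ i, M.1 ≤ (N i).1 := fun h => hN ⟨M, h⟩
  push Not at hM
  obtain ⟨i, hi⟩ := hM
  obtain ⟨v, hvM, hvN⟩ := SetLike.not_le_iff_exists.1 hi
  have hpos : 0 < hρ.seminorm hop (N i) v :=
    (apply_nonneg _ _).lt_of_ne' (mt (hρ.seminorm_eq_zero_iff hop (N i) v).1 hvN)
  obtain ⟨c, hc⟩ := NormedField.exists_lt_norm 𝕜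
    ((1 + hρ.seminorm hop (N i) y) / hρ.seminorm hop (N i) v)
  refine ⟨c • v, hMV (M.1.smul_mem c hvM), i, ?_⟩
  rw [div_lt_iff₀ hpos, ← map_smul_eq_mul] at hc
  have h := map_sub_le_add (hρ.seminorm hop (N i)) (y + c • v) y
  rw [add_sub_cancel_left] at h
  linarith

include hρ hop hX in
theorem exists_le_of_forall_initial {I : Type v} [LinearOrder I] [WellFoundedLT I]
    (N : I → GdeltaSubspace 𝕜 X)
    (hN : ∀ i, ∃ M : GdeltaSubspace 𝕜 X, ∀ j ≤ i, M.1 ≤ (N j).1) :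
    ∃ M : GdeltaSubspace 𝕜 X, ∀ i, M.1 ≤ (N i).1 := by
  by_contra hcon
  let A : I → Set X := fun i => ⋃ j ≤ i, {x | 1 ≤ hρ.seminorm hop (N j) x}
  let C : I → Set X := fun i => closure (A i)
  have hAmono : Monotone A := fun i k hik =>
    biUnion_subset_biUnion_left fun j (hj : j ≤ i) => hj.trans hik
  have hCmono : Monotone C := fun i k hik => closure_mono (hAmono hik)
  -- A lower bound `M` of the N_j with j ≤ i lies in the kernel of each p_{N_j}, so translations by
  -- `M` preserve these seminorms and `C i`.
  have hC : ∀ i, C i ∈ closedGdelta X := by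
    intro i
    obtain ⟨M, hM⟩ := hN i
    refine hρ.mem_closedGdelta_of_invariant hop hX M isClosed_closure fun x hx m hm => ?_
    refine map_mem_closure (f := fun y => y + m) (continuous_add_const m) hx fun a ha => ?_
    obtain ⟨j, hj, haj⟩ := mem_iUnion₂.1 ha
    refine mem_iUnion₂.2 ⟨j, hj, ?_⟩
    rw [mem_ofPred_eq] at haj ⊢
    refine haj.trans ?_
    have h0 := (hρ.seminorm_eq_zero_iff hop (N j) m).2 (hM j hj hm)
    have h := map_sub_le_add (hρ.seminorm hop (N j)) (a + m) m
    rwa [add_sub_cancel_right, h0, add_zero] at h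
  have hC0 : ∀ i, (0 : X) ∉ C i := by
    intro i h0
    obtain ⟨M, hM⟩ := hN i
    have hsub : C i ⊆ {x | 1 ≤ hρ.seminorm hop M x} := by
      refine closure_minimal (iUnion₂_subset fun j hj x hx => ?_)
        (isClosed_le continuous_const (hρ.continuous_seminorm hop M))
      exact le_trans hx (hρ.seminorm_anti hop (hM j hj) x)
    have := hsub h0
    simp only [mem_ofPred_eq, map_zero] at this
    linarith
  have huniv : closure (⋃ i, C i) = univ := by
    refine eq_univ_of_forall fun y => mem_closure_iff_nhds.2 fun t ht => ?_
    have hV : {v | y + v ∈ t} ∈ 𝓝 (0 : X) :=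
      (continuous_const_add y).continuousAt.preimage_mem_nhds (by simpa using ht)
    obtain ⟨v, hv, i, hi⟩ := hρ.exists_large_add_mem hop hX hcon y hV
    exact ⟨y + v, hv, mem_iUnion.2 ⟨i, subset_closure (mem_iUnion₂.2 ⟨i, le_rfl, hi⟩)⟩⟩
  have huniv_mem : (univ : Set X) ∈ closedGdelta X := ⟨isClosed_univ, .univ⟩
  have hinf : ⨅ i, ρ 0 (C i) = 0 := by
    rw [← hρ.N4 I C hCmono hC (by rwa [huniv]) 0, huniv]
    exact (hρ.N1 0 univ huniv_mem).2 (mem_univ 0)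
  have hseq : ∀ n : ℕ, ∃ i, ρ 0 (C i) < ((n : ℝ≥0∞) + 1)⁻¹ := fun n =>
    iInf_lt_iff.1 (by rw [hinf]; simp)
  choose i hi using hseq
  choose M hM using fun n => hN (i n)
  obtain ⟨L, hL⟩ := GdeltaSubspace.exists_le M
  refine hcon ⟨L, fun j => ?_⟩
  by_cases hj : ∃ n, j ≤ i n
  · obtain ⟨n, hn⟩ := hj
    exact (hL n).trans (hM n j hn)
  -- An index `j` beyond all `i n` would give ρ(0, C j) ≤ ρ(0, C (i n)) for all n, hence ρ(0, C j) =
  -- 0 and 0 ∈ C j.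
  · push Not at hj
    refine absurd ((hρ.N1 0 (C j) (hC j)).1 ?_) (hC0 j)
    by_contra hne
    obtain ⟨n, hn⟩ := ENNReal.exists_inv_nat_lt hne
    have h1 : ρ 0 (C j) ≤ ρ 0 (C (i n)) := hρ.N2 0 _ (hC _) _ (hC _) (hCmono (hj n).le)
    have h2 : ((n : ℝ≥0∞) + 1)⁻¹ ≤ (n : ℝ≥0∞)⁻¹ := ENNReal.inv_le_inv.2 le_self_add
    exact absurd (h1.trans_lt ((hi n).trans_le h2)) hn.not_gt

include hρ hop hX in
theorem exists_least_gdeltaSubspace :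
    ∃ M : GdeltaSubspace 𝕜 X, ∀ N : GdeltaSubspace 𝕜 X, M.1 ≤ N.1 := by
  -- The well-order is arbitrary and unrelated to inclusion; it serves only to index the transfinite
  -- sequences in (N4).
  obtain ⟨_, _⟩ := exists_wellFoundedLT (GdeltaSubspace 𝕜 X)
  refine hρ.exists_le_of_forall_initial hop hX id fun N => ?_
  induction N using WellFoundedLT.induction with
  | ind N ih =>
    obtain ⟨M, hM⟩ := hρ.exists_le_of_forall_initial hop hX
      (fun j : Iio N => (j : GdeltaSubspace 𝕜 X)) fun i => by
        obtain ⟨M, hM⟩ := ih i i.2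
        exact ⟨M, fun j hj => hM j hj⟩
    obtain ⟨L, hL⟩ := GdeltaSubspace.exists_le fun n : ℕ => if n = 0 then M else N
    refine ⟨L, fun j hj => ?_⟩
    rcases hj.lt_or_eq with h | rfl
    · exact (hL 0).trans (by simpa using hM ⟨j, h⟩)
    · simpa using hL 1

include hρ hop hX in
/-- The topology of a κ-normed space is given by a single seminorm `ρ(·, M)`. -/
theorem exists_seminorm_ball_subset : ∃ M : GdeltaSubspace 𝕜 X, ∀ V ∈ 𝓝 (0 : X), ∃ ε > 0,
    ∀ x, hρ.seminorm hop M x < ε → x ∈ V := by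
  obtain ⟨M, hM⟩ := hρ.exists_least_gdeltaSubspace hop hX
  refine ⟨M, fun V hV => ?_⟩
  obtain ⟨V', hV', hadd⟩ := exists_nhds_zero_half hV
  obtain ⟨N, hN⟩ := hX.exists_subspace V' hV'
  obtain ⟨ε, hε, h⟩ := hρ.exists_ball_subset_add hop hX M hV'
  refine ⟨ε, hε, fun x hx => ?_⟩
  -- x = v + m with v ∈ V' and m ∈ M ⊆ N ⊆ V', so x ∈ V' + V' ⊆ V.
  obtain ⟨v, hv, m, hm, rfl⟩ := h x hx
  exact hadd v hv m (hN (hM N hm))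

end IsKappaNorm

end WellOrder

/-! ### Passing to a seminormed space -/

section Renorming

variable {𝕜 : Type*} [NormedField 𝕜] {X : Type*} [AddCommGroup X] [Module 𝕜 X] [UniformSpace X]
  [IsUniformAddGroup X]

/-- The seminormed group structure given by a continuous seminorm whose balls form a base of
neighbourhoods of zero; its uniformity is the given one. -/
abbrev seminormedGroupOf (p : Seminorm 𝕜 X) (hp : Continuous p)
    (hball : ∀ V ∈ 𝓝 (0 : X), ∃ ε > 0, ∀ x, p x < ε → x ∈ V) : SeminormedAddCommGroup X :=
  { ‹AddCommGroup X› with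
    norm := p
    dist := fun x y => p (-x + y)
    dist_self := fun x => by simp
    dist_comm := fun x y => by rw [← map_neg_eq_map]; congr 1; abel
    dist_triangle := fun x y z => by
      have := map_add_le_add p (-x + y) (-y + z)
      rwa [show -x + y + (-y + z) = -x + z by abel] at this
    toUniformSpace := ‹UniformSpace X›
    uniformity_dist := by
      have h : (𝓝 (0 : X)).HasBasis (fun ε : ℝ => 0 < ε) fun ε => {x | p x < ε} := by
        refine ⟨fun V => ⟨fun hV => hball V hV, fun ⟨ε, hε, h⟩ => mem_of_superset ?_ h⟩⟩
        exact (isOpen_lt hp continuous_const).mem_nhds (by simpa using hε)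
      rw [uniformity_eq_comap_nhds_zero]
      refine (h.comap _).eq_biInf.trans ?_
      simp only [neg_add_eq_sub]
      rfl
    dist_eq := fun _ _ => rfl }

/-- The normed space structure on `seminormedGroupOf`. -/
abbrev normedSpaceOf (p : Seminorm 𝕜 X) (hp : Continuous p)
    (hball : ∀ V ∈ 𝓝 (0 : X), ∃ ε > 0, ∀ x, p x < ε → x ∈ V) :
    @NormedSpace 𝕜 X _ (seminormedGroupOf p hp hball) :=
  letI := seminormedGroupOf p hp hball
  { ‹Module 𝕜 X› with
    norm_smul_le := fun c x => (map_smul_eq_mul p c x).le }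

end Renorming

/-! ### Transfer to L(X), and consequences of local convexity -/

section Main

variable {𝕜 : Type*} [NontriviallyNormedField 𝕜] {X : Type v} [AddCommGroup X] [Module 𝕜 X]
  [UniformSpace X] [IsUniformAddGroup X] [ContinuousSMul 𝕜 X]

theorem operator_enorm_add_le {X : Type*} [SeminormedAddCommGroup X] [NormedSpace 𝕜 X]
    (S T : X →L[𝕜] X) : ‖S + T‖ₑ ≤ ‖S‖ₑ + ‖T‖ₑ := by
  rw [← ofReal_norm, ← ofReal_norm, ← ofReal_norm, ← ENNReal.ofReal_add (norm_nonneg S)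
    (norm_nonneg T)]
  exact ENNReal.ofReal_le_ofReal (S.opNorm_add_le T)

theorem KappaNormable.conditionallyKappaNormable_add (hX : GdeltaSeparated 𝕜 X)
    (h : KappaNormable 𝕜 (fun s t => s + t) X) (𝒱 : ZeroBase 𝕜 X) :
    ConditionallyKappaNormable (fun s t => s + t) 𝒱 := by
  obtain ⟨ρ, hρ⟩ := h
  have hop := isTriangleOp_add
  obtain ⟨M, hM⟩ := hρ.exists_seminorm_ball_subset hop hX
  -- The new structure keeps the given uniformity definitionally, so `𝒱` and the uniformity of L(X)
  -- are unchanged.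
  let _ := seminormedGroupOf (hρ.seminorm hop M) (hρ.continuous_seminorm hop M) hM
  let _ := normedSpaceOf (hρ.seminorm hop M) (hρ.continuous_seminorm hop M) hM
  exact conditionallyKappaNormable_of_seminormed hop operator_enorm_add_le 𝒱

theorem enorm_add_le_max_of_ultrametric {X : Type*} [SeminormedAddCommGroup X] [NormedSpace 𝕜 X]
    (h : ∀ x y : X, ‖x + y‖ ≤ max ‖x‖ ‖y‖) (S T : X →L[𝕜] X) :
    ‖S + T‖ₑ ≤ max ‖S‖ₑ ‖T‖ₑ := by
  have hle : ‖S + T‖ ≤ max ‖S‖ ‖T‖ := by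
    refine (S + T).opNorm_le_bound (le_max_of_le_left (norm_nonneg S)) fun x => ?_
    refine (h _ _).trans ?_
    rw [max_mul_of_nonneg _ _ (norm_nonneg x)]
    exact max_le_max (S.le_opNorm x) (T.le_opNorm x)
  rw [← ofReal_norm, ← ofReal_norm, ← ofReal_norm, ← ENNReal.ofReal_max]
  exact ENNReal.ofReal_le_ofReal hle

theorem KappaNormable.conditionallyKappaNormable_max (hX : GdeltaSeparated 𝕜 X)
    (h : KappaNormable 𝕜 (fun s t => max s t) X) (𝒱 : ZeroBase 𝕜 X) :
    ConditionallyKappaNormable (fun s t => max s t) 𝒱 := by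
  obtain ⟨ρ, hρ⟩ := h
  have hop := isTriangleOp_max
  obtain ⟨M, hM⟩ := hρ.exists_seminorm_ball_subset hop hX
  let _ := seminormedGroupOf (hρ.seminorm hop M) (hρ.continuous_seminorm hop M) hM
  let _ := normedSpaceOf (hρ.seminorm hop M) (hρ.continuous_seminorm hop M) hM
  refine conditionallyKappaNormable_of_seminormed hop
    (enorm_add_le_max_of_ultrametric fun x y => ?_) 𝒱
  change (ρ (x + y) M.1).toReal ≤ max (ρ x M.1).toReal (ρ y M.1).toReal
  rw [← ENNReal.toReal_max (hρ.ne_top M x) (hρ.ne_top M y)]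
  exact ENNReal.toReal_mono (max_lt (hρ.ne_top M x).lt_top (hρ.ne_top M y).lt_top).ne
    (hρ.apply_add_le M x y)

/-- The complement of an open subgroup is clopen. -/
theorem compl_mem_closedGdelta_of_addSubgroup {X : Type*} [AddGroup X] [TopologicalSpace X]
    [ContinuousAdd X] (G : AddSubgroup X) (hG : (G : Set X) ∈ 𝓝 0) :
    (G : Set X)ᶜ ∈ closedGdelta X := by
  have ho : IsOpen (G : Set X) := G.isOpen_of_mem_nhds hG
  exact ⟨ho.isClosed_compl, (G.isClosed_of_isOpen ho).isOpen_compl.isGδ⟩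

/-- Absolutely convex neighbourhoods of zero are open subgroups G, hence clopen. The largest
subspace inside G is the countable intersection of the clopen sets c⁻ⁿG with ‖c‖ > 1, and G + M is
again an open subgroup. -/
theorem LocallyKConvex.gdeltaSeparated (h : LocallyKConvex 𝕜 X) : GdeltaSeparated 𝕜 X := by
  have hsub : ∀ V ∈ 𝓝 (0 : X), ∃ G : AddSubgroup X, (G : Set X) ∈ 𝓝 0 ∧ (G : Set X) ⊆ V ∧
      ∀ a : 𝕜, ‖a‖ ≤ 1 → ∀ x ∈ G, a • x ∈ G := by
    intro V hV
    obtain ⟨G, hG, hGV, hconv⟩ := h V hV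
    refine ⟨{ carrier := G
              zero_mem' := mem_of_mem_nhds hG
              add_mem' := fun {x y} hx hy => by
                simpa using hconv 1 1 (by simp) (by simp) x hx y hy
              neg_mem' := fun {x} hx => by
                simpa using hconv (-1) 0 (by simp) (by simp) x hx x hx }, hG, hGV, ?_⟩
    intro a ha x hx
    have := hconv a 0 ha (by simp) x hx x hx
    rwa [zero_smul, add_zero] at this
  refine ⟨fun V hV => ?_, fun V hV M => ?_⟩
  · obtain ⟨G, hG, hGV, hsmul⟩ := hsub V hV
    obtain ⟨c, hc⟩ := NormedField.exists_one_lt_norm 𝕜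
    let N : Submodule 𝕜 X :=
      { carrier := {x | ∀ a : 𝕜, a • x ∈ G}
        zero_mem' := fun a => by simp
        add_mem' := fun {x y} hx hy a => by rw [smul_add]; exact G.add_mem (hx a) (hy a)
        smul_mem' := fun b x hx a => by rw [smul_smul]; exact hx _ }
    have hN : (N : Set X) = ⋂ n : ℕ, {x | c ^ n • x ∈ G} := by
      refine Subset.antisymm (fun x hx => mem_iInter.2 fun n => hx _) fun x hx a => ?_
      obtain ⟨n, hn⟩ := pow_unbounded_of_one_lt ‖a‖ hc
      have hcn : c ^ n ≠ 0 := pow_ne_zero _ (norm_pos_iff.1 (one_pos.trans hc))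
      have := hsmul (a / c ^ n) (by
        rw [norm_div, norm_pow]
        exact div_le_one_of_le₀ hn.le (by positivity)) _ (mem_iInter.1 hx n)
      rwa [smul_smul, div_mul_cancel₀ _ hcn] at this
    have hGo : IsOpen (G : Set X) := G.isOpen_of_mem_nhds hG
    refine ⟨⟨N, ?_⟩, fun x hx => hGV (by simpa using hx 1)⟩
    rw [hN]
    exact ⟨isClosed_iInter fun n => (G.isClosed_of_isOpen hGo).preimage (continuous_const_smul _),
      .iInter fun n => (hGo.preimage (continuous_const_smul _)).isGδ⟩
  · obtain ⟨G, hG, hGV, -⟩ := hsub V hV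
    have hGM : ((G ⊔ M.toAddSubgroup : AddSubgroup X) : Set X) ∈ 𝓝 0 :=
      mem_of_superset hG (SetLike.coe_subset_coe.2 le_sup_left)
    refine ⟨_, compl_mem_closedGdelta_of_addSubgroup _ hGM, fun h0 => h0 (zero_mem _), ?_, ?_⟩
    · intro x hx m hm hxm
      have hm' : m ∈ G ⊔ M.toAddSubgroup := (le_sup_right : M.toAddSubgroup ≤ _) hm
      exact hx (by simpa using sub_mem hxm hm')
    · rw [compl_compl]
      intro x hx
      obtain ⟨g, hg, m, hm, rfl⟩ := AddSubgroup.mem_sup.1 hx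
      exact add_mem_add (hGV hg) hm

end Main

/-- The subspace is the largest `𝕜`-subspace on which a continuous real seminorm q vanishes; the
invariant set is the complement of G + M with G open and convex, a closed Gδ because it equals
{gauge ≥ 1}. -/
theorem gdeltaSeparated_of_locallyConvexSpace {𝕜 : Type*} [RCLike 𝕜] {X : Type*} [AddCommGroup X]
    [Module 𝕜 X] [Module ℝ X] [IsScalarTower ℝ 𝕜 X] [UniformSpace X] [IsUniformAddGroup X]
    [ContinuousSMul 𝕜 X] [LocallyConvexSpace ℝ X] : GdeltaSeparated 𝕜 X := by
  have : ContinuousSMul ℝ X := IsScalarTower.continuousSMul 𝕜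
  refine ⟨fun V hV => ?_, fun V hV M => ?_⟩
  · have hsemi := PolynormableSpace.withSeminorms ℝ X
    obtain ⟨s, r, hr, hs⟩ := (hsemi.mem_nhds_iff 0 V).1 hV
    set q := s.sup fun p : {p : Seminorm ℝ X // Continuous p} => p.1
    have hq : Continuous q :=
      Seminorm.continuous (r := r) ((hsemi.mem_nhds_iff 0 _).2 ⟨s, r, hr, Subset.rfl⟩)
    let N : Submodule 𝕜 X :=
      { carrier := {x | ∀ a : 𝕜, q (a • x) = 0}
        zero_mem' := fun a => by simp
        add_mem' := fun {x y} hx hy a => by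
          refine le_antisymm ?_ (apply_nonneg q _)
          rw [smul_add]
          exact (map_add_le_add q _ _).trans (by rw [hx a, hy a, add_zero])
        smul_mem' := fun b x hx a => by rw [smul_smul]; exact hx _ }
    -- Writing a = re a + (im a)·I reduces the conditions q(a • x) = 0 to the two cases a = 1 and a
    -- = I.
    have hN : (N : Set X) = q ⁻¹' {0} ∩ (fun x => q ((RCLike.I : 𝕜) • x)) ⁻¹' {0} := by
      refine Subset.antisymm (fun x hx => ⟨by simpa using hx 1, hx RCLike.I⟩) fun x hx a => ?_
      have ha : a • x = RCLike.re a • x + RCLike.im a • ((RCLike.I : 𝕜) • x) := by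
        rw [← algebraMap_smul 𝕜 (RCLike.re a), ← algebraMap_smul 𝕜 (RCLike.im a), smul_smul,
          ← add_smul]
        congr 1
        exact (RCLike.re_add_im a).symm
      refine le_antisymm ?_ (apply_nonneg q _)
      rw [ha]
      refine (map_add_le_add q _ _).trans ?_
      rw [map_smul_eq_mul, map_smul_eq_mul, hx.1,
        show q ((RCLike.I : 𝕜) • x) = 0 from hx.2, mul_zero, mul_zero, add_zero]
    have h0 : ({0} : Set ℝ) ∈ closedGdelta ℝ := ⟨isClosed_singleton, isClosed_singleton.isGδ⟩
    have h1 := preimage_mem_closedGdelta hq h0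
    have h2 := preimage_mem_closedGdelta (hq.comp (continuous_const_smul (RCLike.I : 𝕜))) h0
    refine ⟨⟨N, ?_⟩, fun x hx => hs ?_⟩
    · rw [hN]
      exact ⟨h1.1.inter h2.1, h1.2.inter h2.2⟩
    · have hx0 : q x = 0 := by simpa using hx 1
      rw [Seminorm.mem_ball_zero, hx0]
      exact hr
  · obtain ⟨G, ⟨h0, hGo, hGc⟩, hGV⟩ :=
      (LocallyConvexSpace.convex_open_basis_zero ℝ X).mem_iff.1 hV
    have hMc : Convex ℝ (M : Set X) := fun x hx y hy a b _ _ _ => by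
      rw [← algebraMap_smul 𝕜 a x, ← algebraMap_smul 𝕜 b y]
      exact M.add_mem (M.smul_mem _ hx) (M.smul_mem _ hy)
    have hc : Convex ℝ (G + (M : Set X)) := hGc.add hMc
    have ho : IsOpen (G + (M : Set X)) := hGo.add_right
    have h0' : (0 : X) ∈ G + (M : Set X) := ⟨0, h0, 0, M.zero_mem, add_zero 0⟩
    have hcompl : (G + (M : Set X))ᶜ = gauge (G + (M : Set X)) ⁻¹' Ici 1 := by
      ext x
      rw [mem_preimage, mem_Ici, ← not_lt, mem_compl_iff,
        gauge_lt_one_iff_mem_interior hc (ho.mem_nhds h0'), ho.interior_eq]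
    refine ⟨(G + (M : Set X))ᶜ, ?_, fun h => h h0', ?_, ?_⟩
    · rw [hcompl]
      exact preimage_mem_closedGdelta (continuous_gauge hc (ho.mem_nhds h0'))
        ⟨isClosed_Ici, isClosed_Ici.isGδ⟩
    · rintro x hx m hm ⟨g, hg, m', hm', h⟩
      refine hx ⟨g, hg, m' - m, M.sub_mem hm' hm, ?_⟩
      simp only at h ⊢
      rw [← add_sub_assoc, h, add_sub_cancel_right]
    · rw [compl_compl]
      exact add_subset_add_right hGV

end KappaNorm

theorem theorem2p6 :
    -- the fields `ℝ` and `ℂ`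
    (∀ (𝕜 : Type u) [RCLike 𝕜] (X : Type v) [AddCommGroup X] [Module 𝕜 X] [Module ℝ X]
      [IsScalarTower ℝ 𝕜 X] [UniformSpace X] [IsUniformAddGroup X] [ContinuousSMul 𝕜 X]
      [LocallyConvexSpace ℝ X],
      KappaNorm.KappaNormable 𝕜 (fun s t => s + t) X →
        ∀ 𝒱 : KappaNorm.ZeroBase 𝕜 X, KappaNorm.ConditionallyKappaNormable (fun s t => s + t) 𝒱) ∧
    -- spherically complete non-Archimedean fields with non-trivial norm
    (∀ (K : Type u) [NontriviallyNormedField K] [IsUltrametricDist K] (X : Type v)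
      [AddCommGroup X] [Module K X] [UniformSpace X] [IsUniformAddGroup X] [ContinuousSMul K X],
      KappaNorm.SphericallyComplete K → KappaNorm.LocallyKConvex K X →
      KappaNorm.KappaNormable K (fun s t => max s t) X →
        ∀ 𝒱 : KappaNorm.ZeroBase K X, KappaNorm.ConditionallyKappaNormable (fun s t => max s t) 𝒱) := by
  refine ⟨?_, ?_⟩
  · intro 𝕜 _ X _ _ _ _ _ _ _ _ h 𝒱
    exact h.conditionallyKappaNormable_add KappaNorm.gdeltaSeparated_of_locallyConvexSpace 𝒱
  · intro K _ _ X _ _ _ _ _ _ hX h 𝒱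
    exact h.conditionallyKappaNormable_max hX.gdeltaSeparated 𝒱
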